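/- Let $d\in\{2,3\}$, let $D\subset\mathbb{R}^d$ be a bounded domain with smooth boundary, and for $\Lambda>0$ let $$L^2_\Lambda(D)=\{\gamma\in L^2(D):\ \Lambda^{-1}\le\gamma\le\Lambda \text{ a.e. in } D\}.$$ For $\mu\in L^2_{\Lambda_\mu}(D)$, $\gamma\in L^2_\Lambda(D)$ and $g\in H^{3/2}(\partial D)$ with $0<g_{\min}\le g\le g_{\max}$ a.e. on $\partial D$, let $u=u_\gamma\in H^1(D)$ be the weak solution of $$-\nabla\cdot(\mu\nabla u)+\gamma u=0 \ \text{ in } D,\qquad u=g\ \text{ on }\partial D$$ (boundary values in the sense of traces, test functions in $H^1_0(D)$). Then $u_\gamma$ exists and is unique and $\gamma u_\gamma\in L^2(D)$, so that the forward map $\mathcal{G}:\gamma\mapsto\gamma u_\gamma$ is well defined from $L^2_\Lambda(D)$ to $L^2(D)$, and it is Lipschitz: for all $\Lambda_\mu>0$ and $g_{\max}>0$ there is a constant $C>0$, depending only on $\Lambda_\mu$, $D$ and $g_{\max}$, such that for all $\Lambda>0$, all $\mu$ and $g$ as above and all $\gamma_1,\gamma_2\in L^2_\Lambda(D)$, $$\|\gamma_1u_{\gamma_1}-\gamma_2u_{\gamma_2}\|_{L^2(D)}\le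 C\,(1+\Lambda)\,\|\gamma_1-\gamma_2\|_{L^2(D)}.$$ In particular, for fixed $\Lambda$ the Lipschitz constant depends only on $\Lambda_\mu$, $D$ and $g_{\max}$. -/

import Mathlib

open MeasureTheory Filter Topology
open scoped ContDiff

namespace QPAT

/-- A bounded smooth domain of `ℝ^d`: open, connected, non-empty, bounded, and near each boundary
point the region `{ρ < 0}` of a smooth function `ρ` without critical points. -/
structure IsSmoothBoundedDomain {d : ℕ} (D : Set (EuclideanSpace ℝ (Fin d))) : Prop where
  isOpen : IsOpen D
  isConnected : IsConnected D
  isBounded : Bornology.IsBounded D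
  smooth_boundary : ∀ x ∈ frontier D, ∃ U : Set (EuclideanSpace ℝ (Fin d)),
    IsOpen U ∧ x ∈ U ∧ ∃ ρ : EuclideanSpace ℝ (Fin d) → ℝ,
      ContDiffOn ℝ ∞ ρ U ∧ (∀ y ∈ U, fderiv ℝ ρ y ≠ 0) ∧ D ∩ U = {y ∈ U | ρ y < 0}

/-- Surface measure on `∂D`: the `(d - 1)`-dimensional Hausdorff measure on the boundary (its
normalization plays no role below). -/
noncomputable def surfaceMeasure {d : ℕ} (D : Set (EuclideanSpace ℝ (Fin d))) :
    Measure (EuclideanSpace ℝ (Fin d)) :=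
  (Measure.hausdorffMeasure ((d : ℝ) - 1)).restrict (frontier D)

/-- `u ∈ H¹(D)` with weak gradient `G`. -/
structure HasH1Gradient {d : ℕ} (D : Set (EuclideanSpace ℝ (Fin d)))
    (u : EuclideanSpace ℝ (Fin d) → ℝ)
    (G : EuclideanSpace ℝ (Fin d) → EuclideanSpace ℝ (Fin d)) : Prop where
  memLp : MemLp u 2 (volume.restrict D)
  memLp_grad : MemLp G 2 (volume.restrict D)
  weak : ∀ φ : EuclideanSpace ℝ (Fin d) → ℝ, ContDiff ℝ ∞ φ → HasCompactSupport φ →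
    tsupport φ ⊆ D → ∫ x in D, u x • gradient φ x = - ∫ x in D, φ x • G x

/-- `u ∈ H²(D)`: `u` and all components of its weak gradient are in `H¹(D)`. -/
def MemH2 {d : ℕ} (D : Set (EuclideanSpace ℝ (Fin d)))
    (u : EuclideanSpace ℝ (Fin d) → ℝ) : Prop :=
  ∃ G : EuclideanSpace ℝ (Fin d) → EuclideanSpace ℝ (Fin d), HasH1Gradient D u G ∧
    ∀ i : Fin d, ∃ K : EuclideanSpace ℝ (Fin d) → EuclideanSpace ℝ (Fin d),
      HasH1Gradient D (fun x => G x i) K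

/-- `u ∈ H¹(D)` has boundary trace `g ∈ L²(∂D)`: the trace operator is the continuous extension of
`φ ↦ φ|_{∂D}` from functions smooth up to the boundary to `H¹(D)`. -/
def HasTrace {d : ℕ} (D : Set (EuclideanSpace ℝ (Fin d)))
    (u g : EuclideanSpace ℝ (Fin d) → ℝ) : Prop :=
  MemLp g 2 (surfaceMeasure D) ∧
  ∃ G : EuclideanSpace ℝ (Fin d) → EuclideanSpace ℝ (Fin d), HasH1Gradient D u G ∧
  ∃ φ : ℕ → EuclideanSpace ℝ (Fin d) → ℝ, (∀ n, ContDiff ℝ ∞ (φ n)) ∧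
    Tendsto (fun n => eLpNorm (fun x => φ n x - u x) 2 (volume.restrict D)) atTop (𝓝 0) ∧
    Tendsto (fun n => eLpNorm (fun x => gradient (φ n) x - G x) 2 (volume.restrict D))
      atTop (𝓝 0) ∧
    Tendsto (fun n => eLpNorm (fun x => φ n x - g x) 2 (surfaceMeasure D)) atTop (𝓝 0)

/-- `g ∈ H^{3/2}(∂D)`, the space of boundary traces of functions of `H²(D)`. -/
def MemHThreeHalves {d : ℕ} (D : Set (EuclideanSpace ℝ (Fin d)))
    (g : EuclideanSpace ℝ (Fin d) → ℝ) : Prop :=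
  ∃ v : EuclideanSpace ℝ (Fin d) → ℝ, MemH2 D v ∧ HasTrace D v g

/-- `γ ∈ L²_Λ(D)`: `γ ∈ L²(D)` and `Λ⁻¹ ≤ γ ≤ Λ` almost everywhere in `D`. -/
def MemL2Bounded {d : ℕ} (D : Set (EuclideanSpace ℝ (Fin d))) (Λ : ℝ)
    (γ : EuclideanSpace ℝ (Fin d) → ℝ) : Prop :=
  MemLp γ 2 (volume.restrict D) ∧ ∀ᵐ x ∂(volume.restrict D), Λ⁻¹ ≤ γ x ∧ γ x ≤ Λ

/-- `u ∈ H¹(D)` is a weak solution of `-∇ · (μ ∇u) + γ u = 0` in `D`, `u = g` on `∂D`; the test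
functions are those of `H¹₀(D)`, the functions of `H¹(D)` with zero trace. -/
def IsWeakSolution {d : ℕ} (D : Set (EuclideanSpace ℝ (Fin d)))
    (μ γ g u : EuclideanSpace ℝ (Fin d) → ℝ) : Prop :=
  HasTrace D u g ∧
  ∃ G : EuclideanSpace ℝ (Fin d) → EuclideanSpace ℝ (Fin d), HasH1Gradient D u G ∧
    ∀ (v : EuclideanSpace ℝ (Fin d) → ℝ)
      (V : EuclideanSpace ℝ (Fin d) → EuclideanSpace ℝ (Fin d)),
      HasH1Gradient D v V → HasTrace D v (fun _ => 0) →
        ∫ x in D, (μ x * inner ℝ (G x) (V x) + γ x * u x * v x) = 0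

end QPAT

/-! Write `w = u₁ - u₂` and `δ = γ₁ - γ₂`. Then `γ₁ u₁ - γ₂ u₂ = γ₁ w + δ u₂`, and both summands are
controlled once `|u₂| ≤ gmax`.

That bound is the weak maximum principle (`WeakEquation.ae_abs_le`): testing with an increasing
function of `u` that vanishes up to `gmax` makes every term nonnegative, so all of them vanish.

For the first summand, `w` has zero trace and is a test function in both equations. Subtracting them
and dropping the gradient term, which has a sign, gives `∫ γ₁ w² ≤ -∫ δ u₂ w`. The bounds `w² ≤ Λ γ₁
w²` and `(γ₁ w)² ≤ Λ γ₁ w²` then yield `‖γ₁ w‖ ≤ Λ gmax ‖δ‖` (`WeakEquation.eLpNorm_mul_sub_le`).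
Working with the weight `γ₁` keeps the constant linear in `Λ`. In total `C = gmax` suffices.
Uniqueness is the case `γ₁ = γ₂`.

Existence is Lax–Milgram on pairs (function, gradient) of zero trace (`exists_weakEquation`). Since
`γ ≥ Λ⁻¹`, coercivity needs no Poincaré inequality. -/

namespace QPAT

/-! ### Gradients and traces by smooth approximation -/

/-- `u` and `G` are the limits in `L²(D)` of a sequence of smooth functions and of their gradients,
and `g` is the limit in `L²(∂D)` of their boundary values. -/
structure HasTraceWith {d : ℕ} (D : Set (EuclideanSpace ℝ (Fin d)))
    (u : EuclideanSpace ℝ (Fin d) → ℝ) (G : EuclideanSpace ℝ (Fin d) → EuclideanSpace ℝ (Fin d))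
    (g : EuclideanSpace ℝ (Fin d) → ℝ) : Prop where
  memLp : MemLp u 2 (volume.restrict D)
  memLp_grad : MemLp G 2 (volume.restrict D)
  memLp_trace : MemLp g 2 (surfaceMeasure D)
  exists_seq : ∃ φ : ℕ → EuclideanSpace ℝ (Fin d) → ℝ, (∀ n, ContDiff ℝ ∞ (φ n)) ∧
    Tendsto (fun n => eLpNorm (fun x => φ n x - u x) 2 (volume.restrict D)) atTop (𝓝 0) ∧
    Tendsto (fun n => eLpNorm (fun x => gradient (φ n) x - G x) 2 (volume.restrict D))
      atTop (𝓝 0) ∧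
    Tendsto (fun n => eLpNorm (fun x => φ n x - g x) 2 (surfaceMeasure D)) atTop (𝓝 0)

variable {d : ℕ} {D : Set (EuclideanSpace ℝ (Fin d))}

theorem continuous_gradient {φ : EuclideanSpace ℝ (Fin d) → ℝ} (hφ : ContDiff ℝ ∞ φ) :
    Continuous (gradient φ) :=
  (InnerProductSpace.toDual ℝ _).symm.continuous.comp (hφ.continuous_fderiv (by simp))

theorem gradient_add {φ ψ : EuclideanSpace ℝ (Fin d) → ℝ} (hφ : ContDiff ℝ ∞ φ)
    (hψ : ContDiff ℝ ∞ ψ) (x : EuclideanSpace ℝ (Fin d)) :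
    gradient (fun y => φ y + ψ y) x = gradient φ x + gradient ψ x := by
  simp only [gradient]
  rw [fderiv_fun_add (hφ.differentiable (by simp) x) (hψ.differentiable (by simp) x), map_add]

theorem gradient_const_mul {φ : EuclideanSpace ℝ (Fin d) → ℝ} (hφ : ContDiff ℝ ∞ φ) (c : ℝ)
    (x : EuclideanSpace ℝ (Fin d)) :
    gradient (fun y => c * φ y) x = c • gradient φ x := by
  simp only [gradient]
  rw [fderiv_const_mul (hφ.differentiable (by simp) x)]
  simp

theorem gradient_scomp {η : ℝ → ℝ} (hη : ContDiff ℝ ∞ η) {φ : EuclideanSpace ℝ (Fin d) → ℝ}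
    (hφ : ContDiff ℝ ∞ φ) (x : EuclideanSpace ℝ (Fin d)) :
    gradient (fun y => η (φ y)) x = deriv η (φ x) • gradient φ x := by
  have h := (hη.differentiable (by simp) (φ x)).hasDerivAt.comp_hasFDerivAt x
    (hφ.differentiable (by simp) x).hasFDerivAt
  simp only [gradient]
  rw [show (fun y => η (φ y)) = η ∘ φ from rfl, h.fderiv]
  simp

/-- Integration by parts for a smooth function and a test function. -/
theorem integral_smul_gradient_eq_neg {φ ψ : EuclideanSpace ℝ (Fin d) → ℝ}
    (hφ : ContDiff ℝ ∞ φ) (hψ : ContDiff ℝ ∞ ψ) (hψc : HasCompactSupport ψ)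
    (hψD : tsupport ψ ⊆ D) :
    ∫ x in D, φ x • gradient ψ x = - ∫ x in D, ψ x • gradient φ x := by
  have hgc : HasCompactSupport (gradient ψ) := by
    have := hψc.fderiv (𝕜 := ℝ)
    exact this.comp_left (g := (InnerProductSpace.toDual ℝ _).symm) (map_zero _)
  have hsup : Function.support (gradient ψ) ⊆ tsupport ψ := by
    intro x hx
    apply support_fderiv_subset ℝ
    intro h
    apply hx
    simp [gradient, h]
  have hi₁ : Integrable (fun x => φ x • gradient ψ x) volume :=
    (hφ.continuous.smul (continuous_gradient hψ)).integrable_of_hasCompactSupport hgc.smul_left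
  have hi₂ : Integrable (fun x => ψ x • gradient φ x) volume :=
    (hψ.continuous.smul (continuous_gradient hφ)).integrable_of_hasCompactSupport hψc.smul_right
  have hi₃ : Integrable (fun x => φ x * ψ x) volume :=
    (hφ.continuous.mul hψ.continuous).integrable_of_hasCompactSupport hψc.mul_left
  -- Both integrands vanish off `D`, so the integration by parts takes place on the whole space,
  -- without boundary terms.
  rw [setIntegral_eq_integral_of_forall_compl_eq_zero (s := D),
    setIntegral_eq_integral_of_forall_compl_eq_zero (s := D)]
  · refine ext_inner_right ℝ fun v => ?_
    rw [inner_neg_left, real_inner_comm, real_inner_comm v (∫ x, ψ x • gradient φ x), ← integral_inner hi₁,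
      ← integral_inner hi₂]
    have hg : ∀ (f : EuclideanSpace ℝ (Fin d) → ℝ) x, inner ℝ v (gradient f x) = fderiv ℝ f x v := by
      intro f x
      rw [real_inner_comm, gradient, InnerProductSpace.toDual_symm_apply]
    have e₁ := hi₁.const_inner (𝕜 := ℝ) v
    have e₂ := hi₂.const_inner (𝕜 := ℝ) v
    simp only [inner_smul_right, hg] at e₁ e₂ ⊢
    rw [integral_mul_fderiv_eq_neg_fderiv_mul_of_integrable (by simpa only [mul_comm] using e₂) e₁
      hi₃ (fun x _ => hφ.differentiable (by simp) x) (fun x _ => hψ.differentiable (by simp) x)]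
    simp only [mul_comm]
  · intro x hx
    rw [image_eq_zero_of_notMem_tsupport (fun h => hx (hψD h)), zero_smul]
  · intro x hx
    rw [show gradient ψ x = 0 by
      by_contra h
      exact hx (hψD (hsup h)), smul_zero]

theorem integrable_smul_of_memLp {α E : Type*} [MeasurableSpace α] [NormedAddCommGroup E]
    [NormedSpace ℝ E] {m : Measure α} {ψ : α → ℝ} {F : α → E} (hψ : MemLp ψ 2 m)
    (hF : MemLp F 2 m) : Integrable (fun x => ψ x • F x) m :=
  memLp_one_iff_integrable.1 (hF.smul hψ)

/-- Hölder's inequality against the fixed `ψ` turns convergence in `L²` into convergence in `L¹`. -/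
theorem tendsto_integral_smul_of_tendsto_eLpNorm {α E : Type*} [MeasurableSpace α]
    [NormedAddCommGroup E] [NormedSpace ℝ E] {m : Measure α} {ψ : α → ℝ} {f : ℕ → α → E} {F : α → E}
    (hψ : MemLp ψ 2 m) (hF : MemLp F 2 m) (hf : ∀ n, AEStronglyMeasurable (f n) m)
    (h : Tendsto (fun n => eLpNorm (fun x => f n x - F x) 2 m) atTop (𝓝 0)) :
    Tendsto (fun n => ∫ x, ψ x • f n x ∂m) atTop (𝓝 (∫ x, ψ x • F x ∂m)) := by
  have key : ∀ n, eLpNorm ((fun x => ψ x • f n x) - fun x => ψ x • F x) 1 m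
      ≤ eLpNorm ψ 2 m * eLpNorm (fun x => f n x - F x) 2 m := by
    intro n
    have := eLpNorm_smul_le_mul_eLpNorm (p := 2) (q := 2) (r := 1) ((hf n).sub hF.1) hψ.1
    refine le_trans (le_of_eq ?_) this
    congr 1
    ext x
    simp [smul_sub]
  have h0 : Tendsto (fun n => eLpNorm ψ 2 m * eLpNorm (fun x => f n x - F x) 2 m) atTop (𝓝 0) := by
    simpa using ENNReal.Tendsto.const_mul h (Or.inr hψ.2.ne)
  have hFi : Integrable (fun x => ψ x • F x) m := integrable_smul_of_memLp hψ hF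
  refine tendsto_integral_of_L1' _ hFi.1 ?_ (tendsto_of_tendsto_of_tendsto_of_le_of_le
    tendsto_const_nhds h0 (fun _ => zero_le) key)
  -- The `f n` are only assumed measurable; they lie in `L²` as soon as their distance to `F` is
  -- finite.
  have : ∀ᶠ n in atTop, eLpNorm (fun x => f n x - F x) 2 m < 1 :=
    h.eventually (gt_mem_nhds one_pos)
  filter_upwards [this] with n hn
  have h1 : MemLp (fun x => f n x - F x) 2 m := ⟨(hf n).sub hF.1, hn.trans ENNReal.one_lt_top⟩
  have h2 : MemLp (f n) 2 m := by
    refine (h1.add hF).ae_eq (ae_of_all _ fun x => ?_)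
    simp
  exact integrable_smul_of_memLp hψ h2

/-- Integration by parts holds for the smooth approximants, and both of its sides pass to the `L²`
limit. -/
theorem HasTraceWith.hasH1Gradient {u g : EuclideanSpace ℝ (Fin d) → ℝ}
    {G : EuclideanSpace ℝ (Fin d) → EuclideanSpace ℝ (Fin d)} (h : HasTraceWith D u G g) :
    HasH1Gradient D u G := by
  refine ⟨h.memLp, h.memLp_grad, fun ψ hψ hψc hψD => ?_⟩
  obtain ⟨φ, hφ, h₁, h₂, -⟩ := h.exists_seq
  have hψ2 : MemLp ψ 2 (volume.restrict D) :=
    (hψ.continuous.memLp_of_hasCompactSupport hψc).restrict D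
  have hgc : HasCompactSupport (gradient ψ) := by
    have := hψc.fderiv (𝕜 := ℝ)
    exact this.comp_left (g := (InnerProductSpace.toDual ℝ _).symm) (map_zero _)
  have hgψ2 : MemLp (gradient ψ) 2 (volume.restrict D) :=
    ((continuous_gradient hψ).memLp_of_hasCompactSupport hgc).restrict D
  have t₂ := tendsto_integral_smul_of_tendsto_eLpNorm hψ2 h.memLp_grad
    (fun n => (continuous_gradient (hφ n)).aestronglyMeasurable) h₂
  -- Pairing with a fixed `v` makes `⟨v, ∇ψ⟩` a scalar weight, so that the limit lemma applies to `φ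
  -- n → u` as well.
  refine ext_inner_right ℝ fun v => ?_
  have hi : ∀ w : EuclideanSpace ℝ (Fin d) → ℝ, MemLp w 2 (volume.restrict D) →
      inner ℝ (∫ x in D, w x • gradient ψ x) v = ∫ x in D, (inner ℝ v (gradient ψ x)) • w x := by
    intro w hw
    rw [real_inner_comm, ← integral_inner (integrable_smul_of_memLp hw hgψ2)]
    simp only [inner_smul_right, smul_eq_mul, mul_comm]
  have t₁ := tendsto_integral_smul_of_tendsto_eLpNorm (hgψ2.const_inner v) h.memLp
    (fun n => (hφ n).continuous.aestronglyMeasurable) h₁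
  rw [hi u h.memLp]
  have t₃ : Tendsto (fun n => inner ℝ (- ∫ x in D, ψ x • gradient (φ n) x) v) atTop
      (𝓝 (inner ℝ (- ∫ x in D, ψ x • G x) v)) := t₂.neg.inner tendsto_const_nhds
  refine tendsto_nhds_unique (t₁.congr' ?_) t₃
  have : ∀ᶠ n in atTop, eLpNorm (fun x => φ n x - u x) 2 (volume.restrict D) < 1 :=
    h₁.eventually (gt_mem_nhds one_pos)
  filter_upwards [this] with n hn
  have m1 : MemLp (fun x => φ n x - u x) 2 (volume.restrict D) :=
    ⟨((hφ n).continuous.aestronglyMeasurable).sub h.memLp.1, hn.trans ENNReal.one_lt_top⟩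
  have m2 : MemLp (φ n) 2 (volume.restrict D) := by
    refine (m1.add h.memLp).ae_eq (ae_of_all _ fun x => ?_)
    simp
  rw [← hi (φ n) m2, integral_smul_gradient_eq_neg (hφ n) hψ hψc hψD]

theorem HasTraceWith.hasTrace {u g : EuclideanSpace ℝ (Fin d) → ℝ}
    {G : EuclideanSpace ℝ (Fin d) → EuclideanSpace ℝ (Fin d)} (h : HasTraceWith D u G g) :
    HasTrace D u g :=
  ⟨h.memLp_trace, G, h.hasH1Gradient, h.exists_seq⟩

theorem HasTrace.exists_hasTraceWith {u g : EuclideanSpace ℝ (Fin d) → ℝ} (h : HasTrace D u g) :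
    ∃ G, HasTraceWith D u G g := by
  obtain ⟨hg, G, hG, hs⟩ := h
  exact ⟨G, hG.memLp, hG.memLp_grad, hg, hs⟩

/-! ### Uniqueness of the gradient and linearity of the trace -/

/-- Weak gradients are unique. -/
theorem HasH1Gradient.ae_eq (hD : IsOpen D) {u : EuclideanSpace ℝ (Fin d) → ℝ}
    {G G' : EuclideanSpace ℝ (Fin d) → EuclideanSpace ℝ (Fin d)} (h : HasH1Gradient D u G)
    (h' : HasH1Gradient D u G') : G =ᵐ[volume.restrict D] G' := by
  have hm : MemLp (fun x => G x - G' x) 2 (volume.restrict D) := h.memLp_grad.sub h'.memLp_grad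
  have := hD.ae_eq_zero_of_integral_contDiff_smul_eq_zero (μ := volume.restrict D)
    (f := fun x => G x - G' x) ((hm.locallyIntegrable (by norm_num)).locallyIntegrableOn D) (by
      intro ψ hψ hψc hψD
      have hψ2 : MemLp ψ 2 (volume.restrict D) :=
        (hψ.continuous.memLp_of_hasCompactSupport hψc).restrict D
      have i₁ : Integrable (fun x => ψ x • G x) (volume.restrict D) := integrable_smul_of_memLp hψ2 h.memLp_grad
      have i₂ : Integrable (fun x => ψ x • G' x) (volume.restrict D) :=
        integrable_smul_of_memLp hψ2 h'.memLp_grad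
      simp only [smul_sub]
      rw [integral_sub i₁ i₂, sub_eq_zero, ← neg_inj, ← h.weak ψ hψ hψc hψD, h'.weak ψ hψ hψc hψD])
  filter_upwards [this, ae_restrict_mem hD.measurableSet] with x hx hxD
  exact sub_eq_zero.1 (hx hxD)

theorem HasTraceWith.congr {u u' g : EuclideanSpace ℝ (Fin d) → ℝ}
    {G G' : EuclideanSpace ℝ (Fin d) → EuclideanSpace ℝ (Fin d)} (h : HasTraceWith D u G g)
    (hu : u =ᵐ[volume.restrict D] u') (hG : G =ᵐ[volume.restrict D] G') :
    HasTraceWith D u' G' g := by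
  obtain ⟨φ, hφ, h₁, h₂, h₃⟩ := h.exists_seq
  refine ⟨h.memLp.ae_eq hu, h.memLp_grad.ae_eq hG, h.memLp_trace, φ, hφ, ?_, ?_, h₃⟩
  · refine h₁.congr fun n => eLpNorm_congr_ae ?_
    filter_upwards [hu] with x hx
    rw [hx]
  · refine h₂.congr fun n => eLpNorm_congr_ae ?_
    filter_upwards [hG] with x hx
    rw [hx]

/-- The gradient inside `HasTrace` is existential; uniqueness allows it to be replaced by any given
weak gradient. -/
theorem HasTrace.hasTraceWith (hD : IsOpen D) {u g : EuclideanSpace ℝ (Fin d) → ℝ}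
    {G : EuclideanSpace ℝ (Fin d) → EuclideanSpace ℝ (Fin d)} (h : HasTrace D u g)
    (hG : HasH1Gradient D u G) : HasTraceWith D u G g := by
  obtain ⟨G', hG'⟩ := h.exists_hasTraceWith
  exact hG'.congr EventuallyEq.rfl (hG'.hasH1Gradient.ae_eq hD hG)

theorem tendsto_eLpNorm_add {α E : Type*} [MeasurableSpace α] [NormedAddCommGroup E]
    {m : Measure α} {f f' : ℕ → α → E} (hf : ∀ n, AEStronglyMeasurable (f n) m)
    (hf' : ∀ n, AEStronglyMeasurable (f' n) m)
    (h : Tendsto (fun n => eLpNorm (f n) 2 m) atTop (𝓝 0))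
    (h' : Tendsto (fun n => eLpNorm (f' n) 2 m) atTop (𝓝 0)) :
    Tendsto (fun n => eLpNorm (fun x => f n x + f' n x) 2 m) atTop (𝓝 0) :=
  tendsto_of_tendsto_of_tendsto_of_le_of_le tendsto_const_nhds (by simpa using h.add h')
    (fun _ => zero_le) (fun n => eLpNorm_add_le (hf n) (hf' n) (by norm_num))

theorem HasTraceWith.add {u u' g g' : EuclideanSpace ℝ (Fin d) → ℝ}
    {G G' : EuclideanSpace ℝ (Fin d) → EuclideanSpace ℝ (Fin d)} (h : HasTraceWith D u G g)
    (h' : HasTraceWith D u' G' g') :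
    HasTraceWith D (fun x => u x + u' x) (fun x => G x + G' x) (fun x => g x + g' x) := by
  obtain ⟨φ, hφ, h₁, h₂, h₃⟩ := h.exists_seq
  obtain ⟨φ', hφ', h₁', h₂', h₃'⟩ := h'.exists_seq
  refine ⟨h.memLp.add h'.memLp, h.memLp_grad.add h'.memLp_grad, h.memLp_trace.add h'.memLp_trace,
    fun n x => φ n x + φ' n x, fun n => (hφ n).add (hφ' n), ?_, ?_, ?_⟩
  · simp only [add_sub_add_comm]
    exact tendsto_eLpNorm_add
      (fun n => (hφ n).continuous.aestronglyMeasurable.sub h.memLp.1)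
      (fun n => (hφ' n).continuous.aestronglyMeasurable.sub h'.memLp.1) h₁ h₁'
  · simp only [gradient_add (hφ _) (hφ' _), add_sub_add_comm]
    exact tendsto_eLpNorm_add
      (fun n => (continuous_gradient (hφ n)).aestronglyMeasurable.sub h.memLp_grad.1)
      (fun n => (continuous_gradient (hφ' n)).aestronglyMeasurable.sub h'.memLp_grad.1) h₂ h₂'
  · simp only [add_sub_add_comm]
    exact tendsto_eLpNorm_add
      (fun n => (hφ n).continuous.aestronglyMeasurable.sub h.memLp_trace.1)
      (fun n => (hφ' n).continuous.aestronglyMeasurable.sub h'.memLp_trace.1) h₃ h₃'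

theorem tendsto_eLpNorm_of_le_mul {α E F : Type*} [MeasurableSpace α] [NormedAddCommGroup E]
    [NormedAddCommGroup F] {m : Measure α} {f : ℕ → α → E} {f' : ℕ → α → F} {c : ℝ}
    (h : ∀ n, ∀ᵐ x ∂m, ‖f' n x‖ ≤ c * ‖f n x‖)
    (hf : Tendsto (fun n => eLpNorm (f n) 2 m) atTop (𝓝 0)) :
    Tendsto (fun n => eLpNorm (f' n) 2 m) atTop (𝓝 0) :=
  tendsto_of_tendsto_of_tendsto_of_le_of_le tendsto_const_nhds
    (by simpa using ENNReal.Tendsto.const_mul hf (Or.inr ENNReal.ofReal_ne_top))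
    (fun _ => zero_le) (fun n => eLpNorm_le_mul_eLpNorm_of_ae_le_mul (h n) 2)

theorem HasTraceWith.const_smul {u g : EuclideanSpace ℝ (Fin d) → ℝ}
    {G : EuclideanSpace ℝ (Fin d) → EuclideanSpace ℝ (Fin d)} (h : HasTraceWith D u G g) (c : ℝ) :
    HasTraceWith D (fun x => c * u x) (fun x => c • G x) (fun x => c * g x) := by
  obtain ⟨φ, hφ, h₁, h₂, h₃⟩ := h.exists_seq
  refine ⟨h.memLp.const_mul c, h.memLp_grad.const_smul c, h.memLp_trace.const_mul c,
    fun n x => c * φ n x, fun n => contDiff_const.mul (hφ n), ?_, ?_, ?_⟩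
  · refine tendsto_eLpNorm_of_le_mul (c := |c|) (fun n => ae_of_all _ fun x => ?_) h₁
    rw [← mul_sub, norm_mul, Real.norm_eq_abs c]
  · refine tendsto_eLpNorm_of_le_mul (c := |c|) (fun n => ae_of_all _ fun x => ?_) h₂
    rw [gradient_const_mul (hφ n), ← smul_sub, norm_smul, Real.norm_eq_abs c]
  · refine tendsto_eLpNorm_of_le_mul (c := |c|) (fun n => ae_of_all _ fun x => ?_) h₃
    rw [← mul_sub, norm_mul, Real.norm_eq_abs c]

theorem HasTraceWith.sub {u u' g g' : EuclideanSpace ℝ (Fin d) → ℝ}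
    {G G' : EuclideanSpace ℝ (Fin d) → EuclideanSpace ℝ (Fin d)} (h : HasTraceWith D u G g)
    (h' : HasTraceWith D u' G' g') :
    HasTraceWith D (fun x => u x - u' x) (fun x => G x - G' x) (fun x => g x - g' x) := by
  simpa [← sub_eq_add_neg] using h.add (h'.const_smul (-1))

/-- A pair that is arbitrarily close to smooth functions with small boundary values has zero
trace. -/
theorem hasTraceWith_zero_of_forall_exists {u : EuclideanSpace ℝ (Fin d) → ℝ}
    {G : EuclideanSpace ℝ (Fin d) → EuclideanSpace ℝ (Fin d)}
    (hu : MemLp u 2 (volume.restrict D)) (hG : MemLp G 2 (volume.restrict D))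
    (h : ∀ ε : ℝ, 0 < ε → ∃ φ : EuclideanSpace ℝ (Fin d) → ℝ, ContDiff ℝ ∞ φ ∧
      eLpNorm (fun x => φ x - u x) 2 (volume.restrict D) ≤ ENNReal.ofReal ε ∧
      eLpNorm (fun x => gradient φ x - G x) 2 (volume.restrict D) ≤ ENNReal.ofReal ε ∧
      eLpNorm (fun x => φ x - 0) 2 (surfaceMeasure D) ≤ ENNReal.ofReal ε) :
    HasTraceWith D u G (fun _ => 0) := by
  choose φ hφ h₁ h₂ h₃ using fun n : ℕ => h (1 / (n + 1)) (by positivity)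
  have h0 : Tendsto (fun n : ℕ => ENNReal.ofReal (1 / ((n : ℝ) + 1))) atTop (𝓝 0) := by
    simpa using ENNReal.tendsto_ofReal tendsto_one_div_add_atTop_nhds_zero_nat
  exact ⟨hu, hG, MemLp.zero, φ, hφ,
    tendsto_of_tendsto_of_tendsto_of_le_of_le tendsto_const_nhds h0 (fun _ => zero_le) h₁,
    tendsto_of_tendsto_of_tendsto_of_le_of_le tendsto_const_nhds h0 (fun _ => zero_le) h₂,
    tendsto_of_tendsto_of_tendsto_of_le_of_le tendsto_const_nhds h0 (fun _ => zero_le) h₃⟩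

/-! ### Chain rule for smooth truncations -/

/-- Dominated convergence for `‖a n • F‖²`, with majorant `‖C • F‖²`. -/
theorem tendsto_eLpNorm_smul_of_ae_tendsto_zero {α E : Type*} [MeasurableSpace α]
    [NormedAddCommGroup E] [NormedSpace ℝ E] {m : Measure α} {a : ℕ → α → ℝ} {F : α → E} {C : ℝ}
    (ha : ∀ n, AEStronglyMeasurable (a n) m) (hF : MemLp F 2 m) (hC : ∀ n x, |a n x| ≤ C)
    (h : ∀ᵐ x ∂m, Tendsto (fun n => a n x) atTop (𝓝 0)) :
    Tendsto (fun n => eLpNorm (fun x => a n x • F x) 2 m) atTop (𝓝 0) := by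
  have hlim : Tendsto (fun n => ∫⁻ x, ‖a n x • F x‖ₑ ^ (2 : ℝ) ∂m) atTop
      (𝓝 (∫⁻ _, 0 ∂m)) := by
    refine tendsto_lintegral_of_dominated_convergence' (fun x => ‖C • F x‖ₑ ^ (2 : ℝ))
      (fun n => ((ha n).smul hF.1).enorm.pow_const _) (fun n => ae_of_all _ fun x => ?_) ?_ ?_
    · refine ENNReal.rpow_le_rpow ?_ (by norm_num)
      rw [enorm_smul, enorm_smul]
      gcongr
      rw [enorm_le_iff_norm_le, Real.norm_eq_abs, Real.norm_eq_abs]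
      exact (hC n x).trans (le_abs_self C)
    · have := lintegral_rpow_enorm_lt_top_of_eLpNorm_lt_top (p := 2) (by norm_num) (by norm_num)
        (hF.const_smul C).2
      simpa using this.ne
    · filter_upwards [h] with x hx
      have h1 : Tendsto (fun n => a n x • F x) atTop (𝓝 0) := by
        simpa using hx.smul_const (F x)
      have h2 := (ENNReal.continuous_rpow_const (y := 2)).tendsto _ |>.comp h1.enorm
      simpa [Function.comp_def] using h2
  have h3 := (ENNReal.continuous_rpow_const (y := 1 / 2)).tendsto _ |>.comp hlim
  simp only [lintegral_zero] at h3
  rw [ENNReal.zero_rpow_of_pos (by norm_num)] at h3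
  refine h3.congr fun n => ?_
  rw [eLpNorm_eq_lintegral_rpow_enorm_toReal (by norm_num) (by norm_num)]
  simp

/-- Chain rule for the composition with a smooth function of bounded derivative. -/
theorem HasTraceWith.scomp {u g : EuclideanSpace ℝ (Fin d) → ℝ}
    {G : EuclideanSpace ℝ (Fin d) → EuclideanSpace ℝ (Fin d)} (h : HasTraceWith D u G g)
    {η : ℝ → ℝ} (hη : ContDiff ℝ ∞ η) {L : ℝ} (hL : ∀ t, |deriv η t| ≤ L) (h0 : η 0 = 0) :
    HasTraceWith D (fun x => η (u x)) (fun x => deriv η (u x) • G x) (fun x => η (g x)) := by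
  obtain ⟨φ, hφ, h₁, h₂, h₃⟩ := h.exists_seq
  have hlip : ∀ s t, ‖η s - η t‖ ≤ L * ‖s - t‖ := fun s t =>
    Convex.norm_image_sub_le_of_norm_deriv_le (s := Set.univ)
      (fun x _ => hη.differentiable (by simp) x) (fun x _ => hL x) convex_univ
      (Set.mem_univ t) (Set.mem_univ s)
  have hlip0 : ∀ s, ‖η s‖ ≤ L * ‖s‖ := fun s => by simpa [h0] using hlip s 0
  have hη' : Continuous (deriv η) := hη.continuous_deriv (by simp)
  have hηu : AEStronglyMeasurable (fun x => deriv η (u x)) (volume.restrict D) :=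
    hη'.comp_aestronglyMeasurable h.memLp.1
  -- The factor `η' (φ n)` has no Lipschitz control, only continuity; a subsequence converging
  -- almost everywhere makes dominated convergence available for it.
  obtain ⟨ns, hns, hae⟩ := (tendstoInMeasure_of_tendsto_eLpNorm (p := 2) (by norm_num)
    (fun n => (hφ n).continuous.aestronglyMeasurable) h.memLp.1 h₁).exists_seq_tendsto_ae
  refine ⟨h.memLp.of_le_mul (hη.continuous.comp_aestronglyMeasurable h.memLp.1)
      (ae_of_all _ fun x => hlip0 (u x)),
    h.memLp_grad.of_le_mul (c := L) (hηu.smul h.memLp_grad.1) (ae_of_all _ fun x => ?_),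
    h.memLp_trace.of_le_mul (hη.continuous.comp_aestronglyMeasurable h.memLp_trace.1)
      (ae_of_all _ fun x => hlip0 (g x)),
    fun n x => η (φ (ns n) x), fun n => hη.comp (hφ _), ?_, ?_, ?_⟩
  · rw [norm_smul]
    gcongr
    exact hL _
  · exact tendsto_eLpNorm_of_le_mul (fun n => ae_of_all _ fun x => hlip _ _)
      (h₁.comp hns.tendsto_atTop)
  · have hmφ : ∀ n, AEStronglyMeasurable (fun x => deriv η (φ (ns n) x)) (volume.restrict D) :=
      fun n => (hη'.comp (hφ _).continuous).aestronglyMeasurable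
    have key : ∀ n x, gradient (fun y => η (φ (ns n) y)) x - deriv η (u x) • G x
        = deriv η (φ (ns n) x) • (gradient (φ (ns n)) x - G x)
          + (deriv η (φ (ns n) x) - deriv η (u x)) • G x := by
      intro n x
      rw [gradient_scomp hη (hφ _), smul_sub, sub_smul]
      abel
    simp only [key]
    refine tendsto_eLpNorm_add
      (fun n => (hmφ n).smul
        ((continuous_gradient (hφ _)).aestronglyMeasurable.sub h.memLp_grad.1))
      (fun n => ((hmφ n).sub hηu).smul h.memLp_grad.1) ?_ ?_
    · refine tendsto_eLpNorm_of_le_mul (c := L) (fun n => ae_of_all _ fun x => ?_)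
        (h₂.comp hns.tendsto_atTop)
      rw [norm_smul]
      exact mul_le_mul_of_nonneg_right (hL _) (norm_nonneg _)
    · refine tendsto_eLpNorm_smul_of_ae_tendsto_zero (C := L + L) (fun n => (hmφ n).sub hηu)
        h.memLp_grad (fun n x => (abs_sub _ _).trans (add_le_add (hL _) (hL _))) ?_
      filter_upwards [hae] with x hx
      simpa using ((hη'.tendsto _).comp hx).sub_const (deriv η (u x))
  · exact tendsto_eLpNorm_of_le_mul (fun n => ae_of_all _ fun x => hlip _ _)
      (h₃.comp hns.tendsto_atTop)

/-- The transition function is constant on each side of `[0, 1]`, so its continuous derivative has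
compact support. -/
theorem exists_abs_deriv_smoothTransition_le : ∃ L, ∀ t, |deriv Real.smoothTransition t| ≤ L := by
  have hc : Continuous (deriv Real.smoothTransition) :=
    (Real.smoothTransition.contDiff (n := 1)).continuous_deriv le_rfl
  have hs : HasCompactSupport (deriv Real.smoothTransition) := by
    refine HasCompactSupport.intro (isCompact_Icc (a := (0 : ℝ)) (b := 1)) fun t ht => ?_
    rcases lt_or_ge t 0 with h | h
    · have : Real.smoothTransition =ᶠ[𝓝 t] fun _ => 0 := by
        filter_upwards [Iio_mem_nhds h] with s hs
        exact Real.smoothTransition.zero_of_nonpos (le_of_lt hs)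
      rw [this.deriv_eq, deriv_const]
    · have h1 : 1 < t := by
        by_contra h1
        exact ht ⟨h, not_lt.1 h1⟩
      have : Real.smoothTransition =ᶠ[𝓝 t] fun _ => 1 := by
        filter_upwards [Ioi_mem_nhds h1] with s hs
        exact Real.smoothTransition.one_of_one_le (le_of_lt hs)
      rw [this.deriv_eq, deriv_const]
  exact hs.exists_bound_of_continuous hc

/-! ### Bounded coefficients and the weak form -/

theorem MemL2Bounded.ae_abs_le {Λ : ℝ} {γ : EuclideanSpace ℝ (Fin d) → ℝ} (hΛ : 0 < Λ)
    (h : MemL2Bounded D Λ γ) : ∀ᵐ x ∂(volume.restrict D), |γ x| ≤ Λ := by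
  filter_upwards [h.2] with x hx
  rw [abs_of_nonneg ((inv_pos.2 hΛ).le.trans hx.1)]
  exact hx.2

theorem MemL2Bounded.memLp_smul {E : Type*} [NormedAddCommGroup E] [NormedSpace ℝ E] {Λ : ℝ}
    {γ : EuclideanSpace ℝ (Fin d) → ℝ} (hΛ : 0 < Λ) (h : MemL2Bounded D Λ γ)
    {f : EuclideanSpace ℝ (Fin d) → E} (hf : MemLp f 2 (volume.restrict D)) :
    MemLp (fun x => γ x • f x) 2 (volume.restrict D) := by
  refine hf.of_le_mul (c := Λ) (h.1.1.smul hf.1) ?_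
  filter_upwards [h.ae_abs_le hΛ] with x hx
  rw [norm_smul]
  exact mul_le_mul_of_nonneg_right hx (norm_nonneg _)

theorem integrable_inner_of_memLp {α E : Type*} [MeasurableSpace α] [NormedAddCommGroup E]
    [InnerProductSpace ℝ E] {m : Measure α} {F F' : α → E} (hF : MemLp F 2 m) (hF' : MemLp F' 2 m) :
    Integrable (fun x => (inner ℝ (F x) (F' x) : ℝ)) m := by
  refine (hF.norm.integrable_mul hF'.norm).mono (hF.1.inner hF'.1) (ae_of_all _ fun x => ?_)
  simpa using norm_inner_le_norm (𝕜 := ℝ) (F x) (F' x)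

theorem integrable_form {Λμ Λ : ℝ} (hΛμ : 0 < Λμ) (hΛ : 0 < Λ)
    {μ γ u v : EuclideanSpace ℝ (Fin d) → ℝ}
    {G V : EuclideanSpace ℝ (Fin d) → EuclideanSpace ℝ (Fin d)}
    (hμ : MemL2Bounded D Λμ μ) (hγ : MemL2Bounded D Λ γ)
    (hu : MemLp u 2 (volume.restrict D)) (hG : MemLp G 2 (volume.restrict D))
    (hv : MemLp v 2 (volume.restrict D)) (hV : MemLp V 2 (volume.restrict D)) :
    Integrable (fun x => μ x * inner ℝ (G x) (V x)) (volume.restrict D) ∧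
      Integrable (fun x => γ x * u x * v x) (volume.restrict D) := by
  constructor
  · simpa only [inner_smul_left, conj_trivial] using
      integrable_inner_of_memLp (hμ.memLp_smul hΛμ hG) hV
  · exact (hγ.memLp_smul hΛ hu).integrable_mul hv

/-- The weak form of `-∇ · (μ ∇u) + γ u = 0`, where `G = ∇u`. -/
def WeakEquation (D : Set (EuclideanSpace ℝ (Fin d))) (μ γ u : EuclideanSpace ℝ (Fin d) → ℝ)
    (G : EuclideanSpace ℝ (Fin d) → EuclideanSpace ℝ (Fin d)) : Prop :=
  ∀ (v : EuclideanSpace ℝ (Fin d) → ℝ) (V : EuclideanSpace ℝ (Fin d) → EuclideanSpace ℝ (Fin d)),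
    HasTraceWith D v V (fun _ => 0) →
      ∫ x in D, (μ x * inner ℝ (G x) (V x) + γ x * u x * v x) = 0

/-- The trace condition and the equation each carry a gradient of their own; uniqueness merges them,
for the solution and for the test functions. -/
theorem isWeakSolution_iff (hD : IsOpen D) {μ γ g u : EuclideanSpace ℝ (Fin d) → ℝ} :
    IsWeakSolution D μ γ g u ↔ ∃ G, HasTraceWith D u G g ∧ WeakEquation D μ γ u G := by
  constructor
  · rintro ⟨ht, G, hG, h⟩
    exact ⟨G, ht.hasTraceWith hD hG, fun v V hv => h v V hv.hasH1Gradient hv.hasTrace⟩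
  · rintro ⟨G, hG, h⟩
    exact ⟨hG.hasTrace, G, hG.hasH1Gradient, fun v V hV hv => h v V (hv.hasTraceWith hD hV)⟩

/-! ### Maximum principle -/

/-- The weak maximum principle. -/
theorem WeakEquation.ae_le {Λμ Λ : ℝ} (hΛμ : 0 < Λμ) (hΛ : 0 < Λ)
    {μ γ g u : EuclideanSpace ℝ (Fin d) → ℝ}
    {G : EuclideanSpace ℝ (Fin d) → EuclideanSpace ℝ (Fin d)}
    (hμ : MemL2Bounded D Λμ μ) (hγ : MemL2Bounded D Λ γ) (hu : HasTraceWith D u G g)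
    (h : WeakEquation D μ γ u G) {M : ℝ} (hM : 0 ≤ M) (hg : ∀ᵐ x ∂(surfaceMeasure D), g x ≤ M) :
    ∀ᵐ x ∂(volume.restrict D), u x ≤ M := by
  obtain ⟨L, hL⟩ := exists_abs_deriv_smoothTransition_le
  have hd : ∀ t, deriv (fun t => Real.smoothTransition (t - M)) t
      = deriv Real.smoothTransition (t - M) := fun t => deriv_comp_sub_const _ _ _
  -- A smooth substitute for the test function `(u - M)⁺`: increasing, zero for `u ≤ M`, positive
  -- beyond. It vanishes at `0` because `0 ≤ M`, and its trace vanishes because `g ≤ M`.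
  have hη := hu.scomp (η := fun t => Real.smoothTransition (t - M)) (L := L)
    ((Real.smoothTransition.contDiff (n := ⊤)).comp (contDiff_id.sub contDiff_const))
    (fun t => by rw [hd]; exact hL _) (Real.smoothTransition.zero_of_nonpos (by linarith))
  have hη0 : HasTraceWith D (fun x => Real.smoothTransition (u x - M))
      (fun x => deriv Real.smoothTransition (u x - M) • G x) (fun _ => 0) := by
    simp only [hd] at hη
    obtain ⟨φ, hφ, h₁, h₂, h₃⟩ := hη.exists_seq
    refine ⟨hη.memLp, hη.memLp_grad, MemLp.zero, φ, hφ, h₁, h₂,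
      h₃.congr fun n => eLpNorm_congr_ae ?_⟩
    filter_upwards [hg] with x hx
    rw [Real.smoothTransition.zero_of_nonpos (by linarith)]
  obtain ⟨i₁, i₂⟩ := integrable_form hΛμ hΛ hμ hγ hu.memLp hu.memLp_grad hη0.memLp hη0.memLp_grad
  -- The first term is `μ η'(u) |∇u|²` with `η' ≥ 0`; in the second, `u > M ≥ 0` wherever the
  -- truncation is nonzero.
  have hpos : ∀ᵐ x ∂(volume.restrict D),
      0 ≤ μ x * inner ℝ (G x) (deriv Real.smoothTransition (u x - M) • G x) ∧
      0 ≤ γ x * u x * Real.smoothTransition (u x - M) := by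
    filter_upwards [hμ.2, hγ.2] with x hx hx'
    have hμ0 := (inv_pos.2 hΛμ).le.trans hx.1
    have hγ0 := (inv_pos.2 hΛ).le.trans hx'.1
    constructor
    · rw [inner_smul_right]
      exact mul_nonneg hμ0 (mul_nonneg Real.smoothTransition.monotone.deriv_nonneg
        real_inner_self_nonneg)
    · rcases le_or_gt (u x) M with hle | hlt
      · rw [Real.smoothTransition.zero_of_nonpos (by linarith), mul_zero]
      · exact mul_nonneg (mul_nonneg hγ0 (hM.trans hlt.le)) (Real.smoothTransition.nonneg _)
  have hz := (integral_eq_zero_iff_of_nonneg_ae (hpos.mono fun x hx => add_nonneg hx.1 hx.2)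
    (i₁.add i₂)).1 (h _ _ hη0)
  filter_upwards [hz, hpos, hγ.2] with x hx hx' hx''
  by_contra hlt
  push Not at hlt
  have h1 : 0 < γ x * u x * Real.smoothTransition (u x - M) :=
    mul_pos (mul_pos ((inv_pos.2 hΛ).trans_le hx''.1) (hM.trans_lt hlt))
      (Real.smoothTransition.pos_of_pos (by linarith))
  have h2 : μ x * inner ℝ (G x) (deriv Real.smoothTransition (u x - M) • G x)
    + γ x * u x * Real.smoothTransition (u x - M) = 0 := hx
  linarith [hx'.1]

theorem WeakEquation.ae_abs_le {Λμ Λ : ℝ} (hΛμ : 0 < Λμ) (hΛ : 0 < Λ)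
    {μ γ g u : EuclideanSpace ℝ (Fin d) → ℝ}
    {G : EuclideanSpace ℝ (Fin d) → EuclideanSpace ℝ (Fin d)}
    (hμ : MemL2Bounded D Λμ μ) (hγ : MemL2Bounded D Λ γ) (hu : HasTraceWith D u G g)
    (h : WeakEquation D μ γ u G) {M : ℝ} (hM : 0 ≤ M)
    (hg : ∀ᵐ x ∂(surfaceMeasure D), |g x| ≤ M) :
    ∀ᵐ x ∂(volume.restrict D), |u x| ≤ M := by
  have h1 := h.ae_le hΛμ hΛ hμ hγ hu hM (hg.mono fun x hx => (abs_le.1 hx).2)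
  have hneg : WeakEquation D μ γ (fun x => (-1) * u x) (fun x => (-1 : ℝ) • G x) := by
    intro v V hv
    rw [← neg_zero, ← h v V hv, ← integral_neg]
    congr 1
    ext x
    rw [inner_smul_left]
    simp only [conj_trivial]
    ring
  have h2 := hneg.ae_le hΛμ hΛ hμ hγ (hu.const_smul (-1)) hM
    (hg.mono fun x hx => by linarith [(abs_le.1 hx).1])
  filter_upwards [h1, h2] with x hx hx'
  exact abs_le.2 ⟨by linarith, hx⟩

/-! ### Existence by Lax–Milgram -/

/-- Multiplication by a function of `L²_Λ(D)` as an operator on `L²(D)`. -/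
theorem MemL2Bounded.exists_mulOperator {E : Type*} [NormedAddCommGroup E] [InnerProductSpace ℝ E]
    {Λ : ℝ} {γ : EuclideanSpace ℝ (Fin d) → ℝ} (hΛ : 0 < Λ) (h : MemL2Bounded D Λ γ) :
    ∃ T : Lp E 2 (volume.restrict D) →L[ℝ] Lp E 2 (volume.restrict D),
      (∀ f, T f =ᵐ[volume.restrict D] fun x => γ x • f x) ∧
      ∀ f, Λ⁻¹ * ‖f‖ ^ 2 ≤ inner ℝ (T f) f := by
  have hγ : MemLp γ ⊤ (volume.restrict D) := memLp_top_of_bound h.1.1 Λ (h.ae_abs_le hΛ)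
  have hT : ∀ f : Lp E 2 (volume.restrict D),
      (ContinuousLinearMap.lsmul ℝ ℝ : ℝ →L[ℝ] E →L[ℝ] E).holderL (volume.restrict D) ⊤ 2 2
        hγ.toLp f =ᵐ[volume.restrict D] fun x => γ x • f x := by
    intro f
    have := ContinuousLinearMap.coeFn_holder (r := 2)
      (ContinuousLinearMap.lsmul ℝ ℝ : ℝ →L[ℝ] E →L[ℝ] E) hγ.toLp f
    refine EventuallyEq.trans this ?_
    filter_upwards [hγ.coeFn_toLp] with x hx
    simp [hx]
  refine ⟨_, hT, fun f => ?_⟩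
  rw [← real_inner_self_eq_norm_sq, L2.inner_def, L2.inner_def, ← integral_const_mul]
  refine integral_mono_ae ((L2.integrable_inner f f).const_mul _) (L2.integrable_inner _ f) ?_
  filter_upwards [hT f, h.2] with x hx hx'
  rw [hx, inner_smul_left]
  exact mul_le_mul_of_nonneg_right hx'.1 real_inner_self_nonneg

/-- The Hilbert space `L²(D) × L²(D; ℝ^d)`. -/
abbrev PairSpace (D : Set (EuclideanSpace ℝ (Fin d))) : Type :=
  WithLp 2 (Lp ℝ 2 (volume.restrict D) × Lp (EuclideanSpace ℝ (Fin d)) 2 (volume.restrict D))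

/-- `H¹₀(D)`, as the space of pairs of a function of zero trace and its gradient. -/
def zeroTraceSubmodule (D : Set (EuclideanSpace ℝ (Fin d))) : Submodule ℝ (PairSpace D) where
  carrier := {p | HasTraceWith D p.fst p.snd fun _ => 0}
  zero_mem' := by
    have h : HasTraceWith D (fun _ => 0) (fun _ => 0) fun _ => 0 :=
      hasTraceWith_zero_of_forall_exists MemLp.zero MemLp.zero fun ε _ =>
        ⟨fun _ => 0, contDiff_const, by simp, by simp, by simp⟩
    exact h.congr (Lp.coeFn_zero _ _ _).symm (Lp.coeFn_zero _ _ _).symm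
  add_mem' := by
    intro p q hp hq
    have h := HasTraceWith.add hp hq
    simp only [add_zero] at h
    exact h.congr (Lp.coeFn_add p.fst q.fst).symm (Lp.coeFn_add p.snd q.snd).symm
  smul_mem' := by
    intro c p hp
    have h := HasTraceWith.const_smul hp c
    simp only [mul_zero] at h
    exact h.congr (Lp.coeFn_smul c p.fst).symm (Lp.coeFn_smul c p.snd).symm

/-- A diagonal argument: a limit point is `ε/2`-close to a pair of zero trace, which is `ε/2`-close
to a smooth function with small boundary values. This supplies the completeness needed for
Lax–Milgram. -/
theorem isClosed_zeroTraceSubmodule : IsClosed (zeroTraceSubmodule D : Set (PairSpace D)) := by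
  refine isClosed_of_closure_subset fun p hp => ?_
  refine hasTraceWith_zero_of_forall_exists (Lp.memLp _) (Lp.memLp _) fun ε hε => ?_
  have hε' : (0 : ENNReal) < ENNReal.ofReal (ε / 2) := ENNReal.ofReal_pos.2 (half_pos hε)
  obtain ⟨q, hq, hpq⟩ := EMetric.mem_closure_iff.1 hp _ hε'
  obtain ⟨φ, hφ, h₁, h₂, h₃⟩ := HasTraceWith.exists_seq hq
  obtain ⟨n, hn₁, hn₂, hn₃⟩ := ((h₁.eventually (gt_mem_nhds hε')).and
    ((h₂.eventually (gt_mem_nhds hε')).and (h₃.eventually (gt_mem_nhds hε')))).exists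
  have hsum : ENNReal.ofReal ε = ENNReal.ofReal (ε / 2) + ENNReal.ofReal (ε / 2) := by
    rw [← ENNReal.ofReal_add (by positivity) (by positivity), add_halves]
  rw [edist_comm] at hpq
  refine ⟨φ n, hφ n, ?_, ?_, hn₃.le.trans (ENNReal.ofReal_le_ofReal (by linarith))⟩
  · have hd : eLpNorm (fun x => q.fst x - p.fst x) 2 (volume.restrict D) ≤ ENNReal.ofReal (ε / 2) :=
      ((Lp.edist_def q.fst p.fst).symm.le.trans (WithLp.edist_fst_le q p)).trans hpq.le
    rw [hsum]
    refine le_trans (le_trans (le_of_eq ?_) (eLpNorm_add_le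
      ((hφ n).continuous.aestronglyMeasurable.sub (Lp.memLp q.fst).1)
      ((Lp.memLp q.fst).1.sub (Lp.memLp p.fst).1) (by norm_num))) (add_le_add hn₁.le hd)
    congr 1
    ext x
    simp
  · have hd : eLpNorm (fun x => q.snd x - p.snd x) 2 (volume.restrict D) ≤ ENNReal.ofReal (ε / 2) :=
      ((Lp.edist_def q.snd p.snd).symm.le.trans (WithLp.edist_snd_le q p)).trans hpq.le
    rw [hsum]
    refine le_trans (le_trans (le_of_eq ?_) (eLpNorm_add_le
      ((continuous_gradient (hφ n)).aestronglyMeasurable.sub (Lp.memLp q.snd).1)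
      ((Lp.memLp q.snd).1.sub (Lp.memLp p.snd).1) (by norm_num))) (add_le_add hn₂.le hd)
    congr 1
    ext x
    simp

/-- The bilinear form of the equation on `L²(D) × L²(D; ℝ^d)`. -/
theorem exists_bilinearForm {Λμ Λ : ℝ} (hΛμ : 0 < Λμ) (hΛ : 0 < Λ)
    {μ γ : EuclideanSpace ℝ (Fin d) → ℝ} (hμ : MemL2Bounded D Λμ μ) (hγ : MemL2Bounded D Λ γ) :
    ∃ A : PairSpace D →L[ℝ] PairSpace D →L[ℝ] ℝ,
      (∀ p q, A p q = ∫ x in D, (μ x * inner ℝ (p.snd x) (q.snd x) + γ x * p.fst x * q.fst x)) ∧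
      ∀ p, min Λμ⁻¹ Λ⁻¹ * ‖p‖ * ‖p‖ ≤ A p p := by
  obtain ⟨T, hT, hTc⟩ := hγ.exists_mulOperator (E := ℝ) hΛ
  obtain ⟨S, hS, hSc⟩ := hμ.exists_mulOperator (E := EuclideanSpace ℝ (Fin d)) hΛμ
  let π₁ : PairSpace D →L[ℝ] Lp ℝ 2 (volume.restrict D) := WithLp.fstL 2 ℝ _ _
  let π₂ : PairSpace D →L[ℝ] Lp (EuclideanSpace ℝ (Fin d)) 2 (volume.restrict D) :=
    WithLp.sndL 2 ℝ _ _
  obtain ⟨A, hA⟩ : ∃ A : PairSpace D →L[ℝ] PairSpace D →L[ℝ] ℝ,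
      ∀ p q, A p q = inner ℝ (S p.snd) q.snd + inner ℝ (T p.fst) q.fst :=
    ⟨(innerSL ℝ).bilinearComp (S ∘L π₂) π₂ + (innerSL ℝ).bilinearComp (T ∘L π₁) π₁,
      fun p q => rfl⟩
  have hmul : ∀ a b c : ℝ, inner ℝ (a • b) c = a * b * c := by
    intro a b c
    simp [mul_comm]
  refine ⟨A, fun p q => ?_, fun p => ?_⟩
  · rw [hA, L2.inner_def, L2.inner_def,
      ← integral_add (L2.integrable_inner _ _) (L2.integrable_inner _ _)]
    refine integral_congr_ae ?_
    filter_upwards [hT p.fst, hS p.snd] with x hx hx'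
    rw [hx, hx', real_inner_smul_left, hmul]
  -- The term in `γ` controls the function and the term in `μ` its gradient, each with its own lower
  -- bound.
  · rw [hA, mul_assoc, ← sq, WithLp.prod_norm_sq_eq_of_L2, mul_add, add_comm]
    refine add_le_add (le_trans ?_ (hSc p.snd)) (le_trans ?_ (hTc p.fst))
    · exact mul_le_mul_of_nonneg_right (min_le_left _ _) (sq_nonneg _)
    · exact mul_le_mul_of_nonneg_right (min_le_right _ _) (sq_nonneg _)

/-- Existence of weak solutions for boundary values of functions of `H¹(D)`. -/
theorem exists_weakEquation {Λμ Λ : ℝ} (hΛμ : 0 < Λμ) (hΛ : 0 < Λ)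
    {μ γ g v₀ : EuclideanSpace ℝ (Fin d) → ℝ}
    {G₀ : EuclideanSpace ℝ (Fin d) → EuclideanSpace ℝ (Fin d)}
    (hμ : MemL2Bounded D Λμ μ) (hγ : MemL2Bounded D Λ γ) (hv : HasTraceWith D v₀ G₀ g) :
    ∃ u G, HasTraceWith D u G g ∧ WeakEquation D μ γ u G := by
  obtain ⟨A, hA, hAc⟩ := exists_bilinearForm hΛμ hΛ hμ hγ
  have : CompleteSpace (zeroTraceSubmodule D) :=
    isClosed_zeroTraceSubmodule.completeSpace_coe
  let ι := (zeroTraceSubmodule D).subtypeL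
  let B : zeroTraceSubmodule D →L[ℝ] zeroTraceSubmodule D →L[ℝ] ℝ := A.bilinearComp ι ι
  have hB : IsCoercive B :=
    ⟨min Λμ⁻¹ Λ⁻¹, lt_min (inv_pos.2 hΛμ) (inv_pos.2 hΛ), fun p => hAc p⟩
  let p₀ : PairSpace D := WithLp.toLp 2 (hv.memLp.toLp, hv.memLp_grad.toLp)
  -- The lift `p₀` carries the boundary values; the correction `w` of zero trace solves `A w q = -A
  -- p₀ q`.
  let w := hB.continuousLinearEquivOfBilin.symm
    ((InnerProductSpace.toDual ℝ (zeroTraceSubmodule D)).symm (-(A p₀ ∘L ι)))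
  have hw : ∀ q : zeroTraceSubmodule D, A (p₀ + w) q = 0 := by
    intro q
    have h1 : B w q = -(A p₀ q) := by
      rw [← hB.continuousLinearEquivOfBilin_apply, ContinuousLinearEquiv.apply_symm_apply,
        InnerProductSpace.toDual_symm_apply]
      rfl
    have h2 : A w q = -(A p₀ q) := h1
    rw [map_add, add_apply, h2, add_neg_cancel]
  have hp₀ : HasTraceWith D p₀.fst p₀.snd g :=
    hv.congr hv.memLp.coeFn_toLp.symm hv.memLp_grad.coeFn_toLp.symm
  have hsum := hp₀.add (g' := fun _ => 0) w.2
  simp only [add_zero] at hsum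
  refine ⟨(p₀ + w).fst, (p₀ + w).snd,
    hsum.congr (Lp.coeFn_add p₀.fst _).symm (Lp.coeFn_add p₀.snd _).symm, fun v V hV => ?_⟩
  let q : PairSpace D := WithLp.toLp 2 (hV.memLp.toLp, hV.memLp_grad.toLp)
  have e₁ : q.fst =ᵐ[volume.restrict D] v := hV.memLp.coeFn_toLp
  have e₂ : q.snd =ᵐ[volume.restrict D] V := hV.memLp_grad.coeFn_toLp
  have hq : q ∈ zeroTraceSubmodule D := hV.congr e₁.symm e₂.symm
  rw [← hw ⟨q, hq⟩, hA]
  refine integral_congr_ae ?_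
  filter_upwards [e₁, e₂] with x hx hx'
  rw [hx, hx']

/-! ### Energy estimate -/

theorem eLpNorm_le_ofReal_mul_of_integral_sq_le {α E F : Type*} [MeasurableSpace α]
    [NormedAddCommGroup E] [NormedAddCommGroup F] {m : Measure α} {f : α → E} {f' : α → F} {c : ℝ}
    (hc : 0 ≤ c) (hf : MemLp f 2 m) (hf' : MemLp f' 2 m)
    (h : ∫ x, ‖f x‖ ^ 2 ∂m ≤ c ^ 2 * ∫ x, ‖f' x‖ ^ 2 ∂m) :
    eLpNorm f 2 m ≤ ENNReal.ofReal c * eLpNorm f' 2 m := by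
  rw [hf.eLpNorm_eq_integral_rpow_norm (by norm_num) (by norm_num),
    hf'.eLpNorm_eq_integral_rpow_norm (by norm_num) (by norm_num), ← ENNReal.ofReal_mul hc]
  refine ENNReal.ofReal_le_ofReal ?_
  simp only [ENNReal.toReal_ofNat, Real.rpow_ofNat]
  rw [← one_div, ← Real.sqrt_eq_rpow, ← Real.sqrt_eq_rpow]
  refine (Real.sqrt_le_sqrt h).trans ?_
  rw [Real.sqrt_mul (sq_nonneg c), Real.sqrt_sq hc]

/-- Energy estimate for the difference of two solutions, the second one bounded by `M`. -/
theorem WeakEquation.eLpNorm_mul_sub_le {Λμ Λ : ℝ} (hΛμ : 0 < Λμ) (hΛ : 0 < Λ)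
    {μ γ₁ γ₂ g u₁ u₂ : EuclideanSpace ℝ (Fin d) → ℝ}
    {G₁ G₂ : EuclideanSpace ℝ (Fin d) → EuclideanSpace ℝ (Fin d)}
    (hμ : MemL2Bounded D Λμ μ) (hγ₁ : MemL2Bounded D Λ γ₁) (hγ₂ : MemL2Bounded D Λ γ₂)
    (hu₁ : HasTraceWith D u₁ G₁ g) (hu₂ : HasTraceWith D u₂ G₂ g)
    (h₁ : WeakEquation D μ γ₁ u₁ G₁) (h₂ : WeakEquation D μ γ₂ u₂ G₂) {M : ℝ} (hM : 0 ≤ M)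
    (hb : ∀ᵐ x ∂(volume.restrict D), |u₂ x| ≤ M) :
    eLpNorm (fun x => γ₁ x * (u₁ x - u₂ x)) 2 (volume.restrict D) ≤
      ENNReal.ofReal (Λ * M) * eLpNorm (fun x => γ₁ x - γ₂ x) 2 (volume.restrict D) := by
  have hw := hu₁.sub hu₂
  simp only [sub_self] at hw
  obtain ⟨i₁, j₁⟩ :=
    integrable_form hΛμ hΛ hμ hγ₁ hu₁.memLp hu₁.memLp_grad hw.memLp hw.memLp_grad
  obtain ⟨i₂, j₂⟩ :=
    integrable_form hΛμ hΛ hμ hγ₂ hu₂.memLp hu₂.memLp_grad hw.memLp hw.memLp_grad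
  have hf : MemLp (fun x => γ₁ x * (u₁ x - u₂ x)) 2 (volume.restrict D) :=
    hγ₁.memLp_smul hΛ hw.memLp
  have hδ : MemLp (fun x => γ₁ x - γ₂ x) 2 (volume.restrict D) := hγ₁.1.sub hγ₂.1
  have h0 : ∫ x in D, (μ x * inner ℝ (G₁ x) (G₁ x - G₂ x) + γ₁ x * u₁ x * (u₁ x - u₂ x)
      - (μ x * inner ℝ (G₂ x) (G₁ x - G₂ x) + γ₂ x * u₂ x * (u₁ x - u₂ x))) = 0 :=
    (integral_sub (i₁.add j₁) (i₂.add j₂)).trans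
      ((congrArg₂ (· - ·) (h₁ _ _ hw) (h₂ _ _ hw)).trans (sub_self 0))
  have hP : Integrable (fun x => 2 * Λ * (μ x * inner ℝ (G₁ x) (G₁ x - G₂ x)
      + γ₁ x * u₁ x * (u₁ x - u₂ x)
      - (μ x * inner ℝ (G₂ x) (G₁ x - G₂ x) + γ₂ x * u₂ x * (u₁ x - u₂ x))))
      (volume.restrict D) := ((i₁.add j₁).sub (i₂.add j₂)).const_mul (2 * Λ)
  refine eLpNorm_le_ofReal_mul_of_integral_sq_le (by positivity) hf hδ ?_
  -- The difference of the two tested equations integrates to zero, so `2 * Λ` times its integrand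
  -- may be added freely, and a pointwise inequality is enough.
  calc ∫ x in D, ‖γ₁ x * (u₁ x - u₂ x)‖ ^ 2
      ≤ ∫ x in D, (2 * Λ * (μ x * inner ℝ (G₁ x) (G₁ x - G₂ x) + γ₁ x * u₁ x * (u₁ x - u₂ x)
          - (μ x * inner ℝ (G₂ x) (G₁ x - G₂ x) + γ₂ x * u₂ x * (u₁ x - u₂ x)))
          + (Λ * M) ^ 2 * ‖γ₁ x - γ₂ x‖ ^ 2) := by
        refine integral_mono_ae hf.norm.integrable_sq
          (hP.add (hδ.norm.integrable_sq.const_mul _)) ?_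
        filter_upwards [hμ.2, hγ₁.2, hb] with x hμx hγx hbx
        have hμ0 : 0 ≤ μ x := (inv_pos.2 hΛμ).le.trans hμx.1
        have hγ0 : 0 ≤ γ₁ x := (inv_pos.2 hΛ).le.trans hγx.1
        have hγΛ : 1 ≤ Λ * γ₁ x := by
          have := mul_le_mul_of_nonneg_left hγx.1 hΛ.le
          rwa [mul_inv_cancel₀ hΛ.ne'] at this
        have hin : 0 ≤ μ x * (inner ℝ (G₁ x) (G₁ x - G₂ x) - inner ℝ (G₂ x) (G₁ x - G₂ x)) := by
          rw [← inner_sub_left]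
          exact mul_nonneg hμ0 real_inner_self_nonneg
        have hu2 : u₂ x ^ 2 ≤ M ^ 2 := sq_le_sq' (by linarith [(abs_le.1 hbx).1]) (abs_le.1 hbx).2
        simp only [Real.norm_eq_abs, sq_abs]
        set w := u₁ x - u₂ x with hwdef
        have hu1 : u₁ x = w + u₂ x := by rw [hwdef]; ring
        set δ := γ₁ x - γ₂ x with hδdef
        have hg2 : γ₂ x = γ₁ x - δ := by rw [hδdef]; ring
        rw [hu1, hg2]
        have s1 : (γ₁ x * w) ^ 2 ≤ Λ * γ₁ x * w ^ 2 := by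
          have := mul_le_mul_of_nonneg_right hγx.2 (mul_nonneg hγ0 (sq_nonneg w))
          nlinarith
        have s2 : w ^ 2 ≤ Λ * γ₁ x * w ^ 2 := by
          nlinarith [mul_le_mul_of_nonneg_right hγΛ (sq_nonneg w)]
        have s3 : Λ ^ 2 * δ ^ 2 * u₂ x ^ 2 ≤ Λ ^ 2 * δ ^ 2 * M ^ 2 :=
          mul_le_mul_of_nonneg_left hu2 (by positivity)
        have s4 : 0 ≤ Λ * (μ x * (inner ℝ (G₁ x) (G₁ x - G₂ x) - inner ℝ (G₂ x) (G₁ x - G₂ x))) :=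
          mul_nonneg hΛ.le hin
        -- The tested difference is at least `γ₁ w² + δ u₂ w`. The square gives `2Λ δ u₂ w ≥ -w² -
        -- Λ² δ² u₂²`; by `s2` the loss `w²` takes up only half of `2Λ γ₁ w²`, and by `s1` the other
        -- half dominates `(γ₁ w)²`.
        nlinarith [sq_nonneg (Λ * δ * u₂ x + w)]
    _ = (Λ * M) ^ 2 * ∫ x in D, ‖γ₁ x - γ₂ x‖ ^ 2 := by
        rw [integral_add hP (hδ.norm.integrable_sq.const_mul _), integral_const_mul,
          integral_const_mul, h0, mul_zero, zero_add]

end QPAT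

/-! ### Well-posedness and the Lipschitz bound -/

theorem mainTheorem8 (d : ℕ) (hd : d = 2 ∨ d = 3)
    (D : Set (EuclideanSpace ℝ (Fin d))) (hD : QPAT.IsSmoothBoundedDomain D)
    (Λμ : ℝ) (hΛμ : 0 < Λμ) (gmax : ℝ) (hgmax : 0 < gmax) :
    ∃ C : ℝ, 0 < C ∧
      ∀ (Λ : ℝ), 0 < Λ →
      ∀ (μ : EuclideanSpace ℝ (Fin d) → ℝ), QPAT.MemL2Bounded D Λμ μ →
      ∀ (g : EuclideanSpace ℝ (Fin d) → ℝ) (gmin : ℝ), QPAT.MemHThreeHalves D g → 0 < gmin →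
        (∀ᵐ x ∂(QPAT.surfaceMeasure D), gmin ≤ g x ∧ g x ≤ gmax) →
      -- the forward map `γ ↦ γ u` is well defined from `L²_Λ(D)` to `L²(D)`
      (∀ γ : EuclideanSpace ℝ (Fin d) → ℝ, QPAT.MemL2Bounded D Λ γ →
        (∃ u : EuclideanSpace ℝ (Fin d) → ℝ, QPAT.IsWeakSolution D μ γ g u) ∧
        (∀ u u' : EuclideanSpace ℝ (Fin d) → ℝ, QPAT.IsWeakSolution D μ γ g u →
          QPAT.IsWeakSolution D μ γ g u' → u =ᵐ[volume.restrict D] u') ∧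
        (∀ u : EuclideanSpace ℝ (Fin d) → ℝ, QPAT.IsWeakSolution D μ γ g u →
          MemLp (fun x => γ x * u x) 2 (volume.restrict D))) ∧
      -- and it is Lipschitz
      (∀ γ₁ γ₂ : EuclideanSpace ℝ (Fin d) → ℝ,
        QPAT.MemL2Bounded D Λ γ₁ → QPAT.MemL2Bounded D Λ γ₂ →
        ∀ u₁ u₂ : EuclideanSpace ℝ (Fin d) → ℝ,
          QPAT.IsWeakSolution D μ γ₁ g u₁ → QPAT.IsWeakSolution D μ γ₂ g u₂ →
          eLpNorm (fun x => γ₁ x * u₁ x - γ₂ x * u₂ x) 2 (volume.restrict D) ≤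
            ENNReal.ofReal (C * (1 + Λ)) *
              eLpNorm (fun x => γ₁ x - γ₂ x) 2 (volume.restrict D)) := by
  refine ⟨gmax, hgmax, fun Λ hΛ μ hμ g gmin hg hgmin hgb => ?_⟩
  have hgabs : ∀ᵐ x ∂(QPAT.surfaceMeasure D), |g x| ≤ gmax := by
    filter_upwards [hgb] with x hx
    exact abs_le.2 ⟨by linarith [hx.1], hx.2⟩
  refine ⟨fun γ hγ => ⟨?_, fun u u' hu hu' => ?_, fun u hu => ?_⟩,
    fun γ₁ γ₂ hγ₁ hγ₂ u₁ u₂ hu₁ hu₂ => ?_⟩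
  · obtain ⟨v, -, hv⟩ := hg
    obtain ⟨G₀, hG₀⟩ := hv.exists_hasTraceWith
    obtain ⟨u, G, hu⟩ := QPAT.exists_weakEquation hΛμ hΛ hμ hγ hG₀
    exact ⟨u, (QPAT.isWeakSolution_iff hD.isOpen).2 ⟨G, hu⟩⟩
  · obtain ⟨G, hG, hw⟩ := (QPAT.isWeakSolution_iff hD.isOpen).1 hu
    obtain ⟨G', hG', hw'⟩ := (QPAT.isWeakSolution_iff hD.isOpen).1 hu'
    -- With equal coefficients the right-hand side of the energy estimate is zero, and `γ > 0` can
    -- be cancelled.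
    have h := hw.eLpNorm_mul_sub_le hΛμ hΛ hμ hγ hγ hG hG' hw' hgmax.le
      (hw'.ae_abs_le hΛμ hΛ hμ hγ hG' hgmax.le hgabs)
    simp only [sub_self, eLpNorm_zero', mul_zero, nonpos_iff_eq_zero] at h
    have hm : AEStronglyMeasurable (fun x => γ x * (u x - u' x)) (volume.restrict D) :=
      hγ.1.1.mul (hG.memLp.1.sub hG'.memLp.1)
    rw [eLpNorm_eq_zero_iff hm (by norm_num)] at h
    filter_upwards [h, hγ.2] with x hx hx'
    have hpos := (inv_pos.2 hΛ).trans_le hx'.1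
    exact sub_eq_zero.1 ((mul_eq_zero.1 hx).resolve_left hpos.ne')
  · exact hγ.memLp_smul hΛ hu.1.2.choose_spec.1.memLp
  · obtain ⟨G₁, hG₁, hw₁⟩ := (QPAT.isWeakSolution_iff hD.isOpen).1 hu₁
    obtain ⟨G₂, hG₂, hw₂⟩ := (QPAT.isWeakSolution_iff hD.isOpen).1 hu₂
    have hb := hw₂.ae_abs_le hΛμ hΛ hμ hγ₂ hG₂ hgmax.le hgabs
    have h₁ := hw₁.eLpNorm_mul_sub_le hΛμ hΛ hμ hγ₁ hγ₂ hG₁ hG₂ hw₂ hgmax.le hb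
    have h₂ : eLpNorm (fun x => (γ₁ x - γ₂ x) * u₂ x) 2 (volume.restrict D) ≤
        ENNReal.ofReal gmax * eLpNorm (fun x => γ₁ x - γ₂ x) 2 (volume.restrict D) := by
      refine eLpNorm_le_mul_eLpNorm_of_ae_le_mul ?_ 2
      filter_upwards [hb] with x hx
      rw [norm_mul, mul_comm]
      exact mul_le_mul_of_nonneg_right hx (norm_nonneg _)
    -- The first summand costs `Λ * gmax` by the energy estimate, the second `gmax` by the maximum
    -- principle.
    have hsplit : (fun x => γ₁ x * u₁ x - γ₂ x * u₂ x)
        = (fun x => γ₁ x * (u₁ x - u₂ x)) + fun x => (γ₁ x - γ₂ x) * u₂ x := by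
      ext x
      simp only [Pi.add_apply]
      ring
    have hc : ENNReal.ofReal (gmax * (1 + Λ))
        = ENNReal.ofReal (Λ * gmax) + ENNReal.ofReal gmax := by
      rw [← ENNReal.ofReal_add (by positivity) hgmax.le]
      congr 1
      ring
    rw [hsplit, hc, add_mul]
    exact (eLpNorm_add_le (hγ₁.1.1.mul (hG₁.memLp.1.sub hG₂.memLp.1))
      ((hγ₁.1.1.sub hγ₂.1.1).mul hG₂.memLp.1) (by norm_num)).trans (add_le_add h₁ h₂)
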